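/- Let $\mathbb{F}_q$ be a finite field with $q$ elements and let $a_0\in\mathbb{F}_q$. Let $\lambda=(\lambda_1\ge\lambda_2\ge\dots\ge\lambda_k\ge 1)$ be a partition (the empty partition $k=0$ is allowed), with weight $|\lambda|=\lambda_1+\dots+\lambda_k$ and length $l(\lambda)=k$. For $i\ge 1$ let $\lambda'_i$ be the number of parts of $\lambda$ that are greater than or equal to $i$, and put $\langle\lambda,\lambda\rangle=\sum_{i\ge 1}(\lambda'_i)^2$. For $f(x)=x-a_0$ let $J_m(f)$ be the $m\times m$ Jordan block with $a_0$ on the diagonal, $1$ on the superdiagonal and $0$ elsewhere, and let $J_\lambda(f)=J_{\lambda_1}(f)\oplus J_{\lambda_2}(f)\oplus\dots\oplus J_{\lambda_k}(f)$, a matrix of order $|\lambda|$. Then the number of nilpotent $|\lambda|\times|\lambda|$ matrices over $\mathbb{F}_q$ that commute with $J_\lambda(f)$ is $$q^{\langle\lambda,\lambda\rangle-l(\lambda)}.$$ -/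

import Mathlib

open Polynomial

/-- The companion matrix `c(f)` of a monic polynomial `f = a_0 + a_1 x + ⋯ + x^d`, `d = deg f`:
ones on the superdiagonal, and last row `(-a_0, …, -a_{d-1})`. -/
def companionMat {F : Type*} [Field F] (f : F[X]) :
    Matrix (Fin f.natDegree) (Fin f.natDegree) F :=
  Matrix.of fun i j =>
    if (i : ℕ) + 1 = f.natDegree then -f.coeff j
    else if (i : ℕ) + 1 = j then 1 else 0

/-- The Jordan block matrix `J_m(f)`: an `m × m` array of blocks of order `deg f`, with `c(f)` in
the diagonal positions, the identity in the superdiagonal positions and `0` elsewhere. A row or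
column index is a pair (block index, index within the block). -/
def jordanBlockMat {F : Type*} [Field F] (f : F[X]) (m : ℕ) :
    Matrix (Fin m × Fin f.natDegree) (Fin m × Fin f.natDegree) F :=
  Matrix.of fun p r =>
    if p.1 = r.1 then companionMat f p.2 r.2
    else if (p.1 : ℕ) + 1 = r.1 then (1 : Matrix _ _ F) p.2 r.2 else 0

namespace Nat.Partition

/-- The parts `λ_1 ≥ λ_2 ≥ ⋯ ≥ λ_k ≥ 1` of a partition, in weakly decreasing order. -/
def partsList {n : ℕ} (l : n.Partition) : List ℕ := l.parts.sort (· ≥ ·)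

/-- The length `l(λ)`: the number of parts. -/
def length {n : ℕ} (l : n.Partition) : ℕ := l.parts.card

/-- The `i`-th part `λ'_i` (for `i ≥ 1`) of the conjugate partition: the number of parts of `λ`
that are greater than or equal to `i`. -/
def conjPart {n : ℕ} (l : n.Partition) (i : ℕ) : ℕ := l.parts.countP (i ≤ ·)

/-- The pairing `⟨λ, μ⟩ = ∑_{i ≥ 1} λ'_i μ'_i`. The sum stops at the weight of `λ`, beyond which
`λ'_i = 0` (see `conjPart_eq_zero`). -/
def pairing {m n : ℕ} (l : m.Partition) (μ : n.Partition) : ℕ :=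
  ∑ i ∈ Finset.Icc 1 m, l.conjPart i * μ.conjPart i

theorem conjPart_eq_zero {n : ℕ} (l : n.Partition) {i : ℕ} (hi : n < i) : l.conjPart i = 0 := by
  rw [conjPart, Multiset.countP_eq_zero]
  intro a ha h
  have h1 := Multiset.le_sum_of_mem ha
  rw [l.parts_sum] at h1
  omega

theorem conjPart_one {n : ℕ} (l : n.Partition) : l.conjPart 1 = l.length := by
  rw [conjPart, length, Multiset.countP_eq_card]
  exact fun a ha => l.parts_pos ha

/-- The difference `⟨λ, λ⟩ - l(λ)` of natural numbers is never truncated. -/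
theorem length_le_pairing {n : ℕ} (l : n.Partition) : l.length ≤ l.pairing l := by
  rcases Nat.eq_zero_or_pos n with rfl | hn
  · rw [← l.conjPart_one, l.conjPart_eq_zero Nat.zero_lt_one]
    exact Nat.zero_le _
  · rw [← l.conjPart_one]
    exact (Nat.le_mul_self _).trans
      (Finset.single_le_sum (f := fun i => l.conjPart i * l.conjPart i)
        (fun _ _ => Nat.zero_le _) (Finset.mem_Icc.2 ⟨le_rfl, hn⟩))

end Nat.Partition

/-- The index set for the rows and columns of `J_λ(f)`: a position `i` in the list of parts of
`λ`, together with an index for the block `J_{λ_i}(f)`. It has `|λ| · deg f` elements. -/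
abbrev JordanIndex {F : Type*} [Field F] (f : F[X]) {n : ℕ} (l : n.Partition) : Type :=
  Σ i : Fin l.partsList.length, Fin (l.partsList.get i) × Fin f.natDegree

/-- The matrix `J_λ(f) = J_{λ_1}(f) ⊕ J_{λ_2}(f) ⊕ ⋯ ⊕ J_{λ_k}(f)`. -/
def jordanMat {F : Type*} [Field F] (f : F[X]) {n : ℕ} (l : n.Partition) :
    Matrix (JordanIndex f l) (JordanIndex f l) F :=
  Matrix.blockDiagonal' fun i => jordanBlockMat f (l.partsList.get i)

/-!
The identity proved is `#Nil(A) * q ^ l(λ) = #A = q ^ ⟨λ, λ⟩`, where `A` is the centralizer of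
`J_λ(x - a₀)`, that is, of its nilpotent part `N`.

*The centralizer.* Index the rows and columns of `N` by pairs `(i, a)` with `a < λ_i`. A matrix
commutes with `N` exactly when each of its blocks `(i, j)` is an upper triangular Toeplitz matrix,
given by `min (λ_i) (λ_j)` free scalars (`Matrix.commute_jordanShift_iff`). Hence
`#A = q ^ ∑ min (λ_i) (λ_j)`, and the exponent is `⟨λ, λ⟩` (`Nat.Partition.sum_min_eq_pairing`).

*Reduction to full matrix algebras.* In a suitable order of the basis every element of `A` is block
triangular, and its diagonal blocks are copies of matrices `C_d` of order `m_d`, one for each part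
size `d` of multiplicity `m_d`. So it is nilpotent if and only if all `C_d` are
(`Matrix.ToeplitzCoeffs.isNilpotent_toMatrix_iff`). The map `A → ∏ M_{m_d}(F)` is additive and
surjective, so the proportion of nilpotents in `A` is the product of those in the `M_{m_d}(F)`.
As `∑ m_d = l(λ)`, it remains to see that this proportion is `q ^ (-m)` in `M_m(F)`.

*Full matrix algebras.* This is the Fine–Herstein theorem (`Matrix.card_nilpotent`). Fix `v ≠ 0`
in `V = Fᵐ` and follow the chain `v, T v, T² v, …` until it becomes dependent, after `k` vectors
spanning an invariant subspace `W`. Given these `k` vectors, `T` is described by the value in `W`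
which closes the chain, by an endomorphism of `V / W`, and by an off-diagonal block. It is nilpotent
if and only if the value is zero, which has probability `q ^ (-k)`, and the endomorphism of `V / W`
is nilpotent, which has probability `q ^ (-(m - k))` by induction. The product does not depend
on `k`.
-/

/-! ### Counting lemmas -/

/-- If `P` holds for the fraction `1 / N` of the elements of each fibre of `f` on `E`, then it holds
for the fraction `1 / N` of the elements of `E`. -/
theorem Nat.card_subtype_and_mul_eq_of_fiberwise {α β : Type*} [Finite α] (E P : α → Prop) (N : ℕ)
    (f : α → β)
    (h : ∀ b, Nat.card {x // (E x ∧ f x = b) ∧ P x} * N = Nat.card {x // E x ∧ f x = b}) :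
    Nat.card {x // E x ∧ P x} * N = Nat.card {x // E x} := by
  classical
  have := Fintype.ofFinite α
  simp only [Nat.card_eq_fintype_card, Fintype.card_subtype] at h ⊢
  rw [Finset.card_eq_sum_card_fiberwise (f := f) (t := Finset.univ.image f)
      (fun x _ => by simp),
    Finset.card_eq_sum_card_fiberwise (f := f) (s := Finset.univ.filter E)
      (t := Finset.univ.image f) (fun x _ => by simp), Finset.sum_mul]
  refine Finset.sum_congr rfl fun b _ => ?_
  rw [Finset.filter_filter, Finset.filter_filter, ← h b]
  congr 2
  ext x
  simp only [Finset.mem_filter, Finset.mem_univ, true_and]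
  tauto

theorem Nat.card_subtype_mem_range_and {α β : Type*} {g : α → β} (hg : Function.Injective g)
    (P : β → Prop) : Nat.card {y // (∃ x, g x = y) ∧ P y} = Nat.card {x // P (g x)} := by
  refine (Nat.card_congr (Equiv.ofBijective
    (fun x : {x // P (g x)} => (⟨g x, ⟨x, rfl⟩, x.2⟩ : {y // (∃ x, g x = y) ∧ P y})) ⟨?_, ?_⟩)).symm
  · intro x y h
    exact Subtype.ext (hg (congrArg Subtype.val h))
  · rintro ⟨_, ⟨x, rfl⟩, hx⟩
    exact ⟨⟨x, hx⟩, rfl⟩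

/-- The proportion of elements satisfying `P` does not change on pulling back along a surjective
homomorphism. -/
theorem AddMonoidHom.card_subtype_comp_mul_card {G H : Type*} [AddGroup G] [AddGroup H] [Finite G]
    [Finite H] (f : G →+ H) (hf : Function.Surjective f) (P : H → Prop) :
    Nat.card {g // P (f g)} * Nat.card H = Nat.card G * Nat.card {h // P h} := by
  classical
  have := Fintype.ofFinite G
  have := Fintype.ofFinite H
  have key (Q : H → Prop) :
      Nat.card {g // Q (f g)} = Nat.card {h // Q h} * Nat.card {g // f g = 0} := by
    simp only [Nat.card_eq_fintype_card, Fintype.card_subtype]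
    rw [Finset.card_eq_sum_card_fiberwise (f := f) (t := Finset.univ.filter Q)
      (fun x hx => by simpa using hx)]
    refine Finset.sum_const_nat fun h hh => ?_
    rw [← AddMonoidHom.card_fiber_eq_of_mem_range f (hf h) (hf 0)]
    congr 1
    ext x
    simp only [Finset.mem_filter, Finset.mem_univ, true_and] at hh ⊢
    exact ⟨fun h => h.2, fun h => ⟨h ▸ hh, h⟩⟩
  have h1 := key fun _ => True
  have e (α : Type _) : Nat.card {_x : α // True} = Nat.card α :=
    Nat.card_congr (Equiv.subtypeUnivEquiv fun _ => trivial)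
  rw [e, Nat.card_congr (Equiv.subtypeUnivEquiv (p := fun _ : H => True) fun _ => trivial)] at h1
  rw [key P, h1]
  ring

/-! ### Nilpotent matrices over a field -/

namespace Matrix

variable {F : Type*} [Field F]

theorem isNilpotent_iff_charpoly_dvd_X_pow {n : Type*} [Fintype n] [DecidableEq n]
    (M : Matrix n n F) : IsNilpotent M ↔ ∃ k, M.charpoly ∣ X ^ k := by
  constructor
  · intro h
    refine ⟨Fintype.card n, dvd_of_eq (sub_eq_zero.1 ?_)⟩
    exact (isNilpotent_charpoly_sub_pow_of_isNilpotent h).eq_zero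
  · rintro ⟨k, q, hq⟩
    refine ⟨k, ?_⟩
    have := congrArg (aeval M) hq
    simpa [aeval_self_charpoly] using this

theorem IsNilpotent.pow_card_eq_zero {n : Type*} [Fintype n] [DecidableEq n]
    {M : Matrix n n F} (h : IsNilpotent M) : M ^ Fintype.card n = 0 := by
  have h1 : M.charpoly = X ^ Fintype.card n :=
    sub_eq_zero.1 (isNilpotent_charpoly_sub_pow_of_isNilpotent h).eq_zero
  simpa [h1] using aeval_self_charpoly M

theorem isNilpotent_fromBlocks_zero₂₁_iff {m n : Type*} [Fintype m] [DecidableEq m] [Fintype n]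
    [DecidableEq n] (A : Matrix m m F) (B : Matrix m n F) (D : Matrix n n F) :
    IsNilpotent (fromBlocks A B 0 D) ↔ IsNilpotent A ∧ IsNilpotent D := by
  simp only [isNilpotent_iff_charpoly_dvd_X_pow, charpoly_fromBlocks_zero₂₁]
  constructor
  · rintro ⟨k, h⟩
    exact ⟨⟨k, (dvd_mul_right _ _).trans h⟩, ⟨k, (dvd_mul_left _ _).trans h⟩⟩
  · rintro ⟨⟨k, h⟩, ⟨l, h'⟩⟩
    exact ⟨k + l, by rw [pow_add]; exact mul_dvd_mul h h'⟩

theorem BlockTriangular.isNilpotent_iff {n α : Type*} [Fintype n] [DecidableEq n] [LinearOrder α]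
    {M : Matrix n n F} {b : n → α} (h : M.BlockTriangular b) :
    IsNilpotent M ↔ ∀ a ∈ Set.range b, IsNilpotent (M.toSquareBlock b a) := by
  simp only [isNilpotent_iff_charpoly_dvd_X_pow, h.charpoly]
  constructor
  · rintro ⟨k, hk⟩ _ ⟨i, rfl⟩
    exact ⟨k, (Finset.dvd_prod_of_mem (fun a => (M.toSquareBlock b a).charpoly)
      (Finset.mem_image_of_mem b (Finset.mem_univ i))).trans hk⟩
  · intro H
    choose! k hk using H
    refine ⟨∑ a ∈ Finset.univ.image b, k a, ?_⟩
    rw [← Finset.prod_pow_eq_pow_sum]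
    exact Finset.prod_dvd_prod_of_dvd _ _ fun a ha => hk a (by simpa using ha)

/-- The matrix of the endomorphism sending the `j`-th basis vector to the next one, except for the
last basis vector, which goes to `c`: a companion matrix. -/
def shiftWithLastCol {k : ℕ} (c : Fin (k + 1) → F) : Matrix (Fin (k + 1)) (Fin (k + 1)) F :=
  of fun i j => if j = Fin.last k then c i else if (i : ℕ) = j + 1 then 1 else 0

theorem isNilpotent_shiftWithLastCol_iff {k : ℕ} (c : Fin (k + 1) → F) :
    IsNilpotent (shiftWithLastCol c) ↔ c = 0 := by
  constructor
  · intro h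
    -- The powers move the first basis vector through the chain, and the power `k + 1`, which
    -- vanishes for a nilpotent matrix of this order, moves it to `c`.
    have hp : ∀ i : ℕ, ∀ hi : i < k + 1,
        (shiftWithLastCol c ^ i) *ᵥ Pi.single 0 1 = Pi.single ⟨i, hi⟩ 1 := by
      intro i
      induction i with
      | zero => intro _; rw [pow_zero, one_mulVec]; rfl
      | succ i ih =>
        intro hi
        rw [pow_succ', ← mulVec_mulVec, ih (by omega)]
        ext j
        have : i ≠ k := by omega
        simp [shiftWithLastCol, this, Pi.single_apply, Fin.ext_iff]
    have h0 := IsNilpotent.pow_card_eq_zero h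
    have h1 : (shiftWithLastCol c ^ (k + 1)) *ᵥ Pi.single 0 1 = c := by
      rw [pow_succ', ← mulVec_mulVec, hp k (by omega)]
      ext j
      have : (⟨k, by omega⟩ : Fin (k + 1)) = Fin.last k := rfl
      simp [shiftWithLastCol, this]
    rw [Fintype.card_fin] at h0
    rw [← h1, h0, zero_mulVec]
  · rintro rfl
    rw [← isNilpotent_transpose_iff, isNilpotent_iff_charpoly_dvd_X_pow]
    refine ⟨k + 1, dvd_of_eq ?_⟩
    rw [charpoly_of_isUpperTriangular]
    · simp [shiftWithLastCol]
    · intro i j hij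
      have : (j : ℕ) < i := hij
      simp only [shiftWithLastCol, transpose_apply, of_apply, Pi.zero_apply]
      split_ifs <;> first | rfl | omega

end Matrix

/-! ### The number of nilpotent endomorphisms of a vector space -/

section ChainExtensions

variable {F V : Type*} [Field F] [AddCommGroup V] [Module F V]

open Module

/-- In a basis beginning with the chain `w 0, …, w k`, the endomorphisms which move along the chain
and leave its span invariant are the block triangular ones with a companion matrix as first diagonal
block. -/
theorem LinearMap.mem_span_chain_iff_exists_toLin {k r : ℕ} (w : ℕ → V)
    (b : Basis (Fin (k + 1) ⊕ Fin r) F V) (hb : ∀ i : Fin (k + 1), b (Sum.inl i) = w i)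
    (T : End F V) :
    (∃ x : (Fin (k + 1) → F) × Matrix (Fin (k + 1)) (Fin r) F × Matrix (Fin r) (Fin r) F,
        Matrix.toLinAlgEquiv b (Matrix.fromBlocks (Matrix.shiftWithLastCol x.1) x.2.1 0 x.2.2) = T)
      ↔ (∀ i < k, T (w i) = w (i + 1)) ∧
        T (w k) ∈ Submodule.span F (Set.range fun i : Fin (k + 1) => w i) := by
  constructor
  · rintro ⟨⟨c, A, D⟩, rfl⟩
    constructor
    · intro i hi
      have h1 := hb ⟨i, by omega⟩
      have h2 := hb ⟨i + 1, by omega⟩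
      simp only at h1 h2
      rw [← h1, ← h2, Matrix.toLinAlgEquiv_self]
      have : (⟨i, by omega⟩ : Fin (k + 1)) ≠ Fin.last k := by
        simp only [ne_eq, Fin.ext_iff, Fin.val_last]; omega
      rw [Fintype.sum_sum_type, Finset.sum_eq_single ⟨i + 1, by omega⟩]
      · simp [Matrix.shiftWithLastCol, this]
      · intro j _ hj
        simp only [Matrix.fromBlocks_apply₁₁, Matrix.shiftWithLastCol, Matrix.of_apply, if_neg this]
        rw [if_neg, zero_smul]
        intro h
        exact hj (Fin.ext h)
      · simp
    · have h1 := hb (Fin.last k)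
      simp only [Fin.val_last] at h1
      rw [← h1, Matrix.toLinAlgEquiv_self, Fintype.sum_sum_type]
      simp only [Matrix.fromBlocks_apply₁₁, Matrix.fromBlocks_apply₂₁, Matrix.zero_apply, zero_smul,
        Finset.sum_const_zero, add_zero, hb]
      exact Submodule.sum_mem _ fun i _ => Submodule.smul_mem _ _ (Submodule.subset_span ⟨i, rfl⟩)
  · rintro ⟨h1, h2⟩
    obtain ⟨c, hc⟩ := (Submodule.mem_span_range_iff_exists_fun F).1 h2
    let M := LinearMap.toMatrixAlgEquiv b T
    refine ⟨⟨c, M.toBlocks₁₂, M.toBlocks₂₂⟩, ?_⟩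
    refine b.ext fun j => ?_
    rw [Matrix.toLinAlgEquiv_self, Fintype.sum_sum_type]
    rcases j with j | j
    · simp only [Matrix.fromBlocks_apply₁₁, Matrix.fromBlocks_apply₂₁, Matrix.zero_apply, zero_smul,
        Finset.sum_const_zero, add_zero, hb]
      by_cases hj : j = Fin.last k
      · subst hj
        simpa [Matrix.shiftWithLastCol] using hc
      · have hj' : (j : ℕ) < k := Fin.val_lt_last hj
        rw [h1 j hj', Finset.sum_eq_single ⟨j + 1, by omega⟩]
        · simp [Matrix.shiftWithLastCol, hj]
        · intro i _ hi
          simp only [Matrix.shiftWithLastCol, Matrix.of_apply, if_neg hj]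
          rw [if_neg, zero_smul]
          intro h
          exact hi (Fin.ext h)
        · simp
    · simp only [Matrix.fromBlocks_apply₁₂, Matrix.fromBlocks_apply₂₂, Matrix.toBlocks₁₂,
        Matrix.toBlocks₂₂, Matrix.of_apply]
      rw [← Fintype.sum_sum_type (fun i => M i (Sum.inr j) • b i), ← Matrix.toLinAlgEquiv_self]
      simp [M]

/-- If `w 0, …, w k` is independent, exactly the fraction `|V|⁻¹` of the endomorphisms which send
`w i` to `w (i + 1)` for `i < k` and leave the span of the chain invariant is nilpotent, provided
this fraction is right in dimension `dim V - (k + 1)`. -/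
theorem LinearMap.card_nilpotent_of_invariant_chain [Finite F] {k r : ℕ} (w : ℕ → V)
    (b : Basis (Fin (k + 1) ⊕ Fin r) F V) (hb : ∀ i : Fin (k + 1), b (Sum.inl i) = w i)
    (hr : Nat.card {D : Matrix (Fin r) (Fin r) F // IsNilpotent D} * Nat.card F ^ r =
      Nat.card (Matrix (Fin r) (Fin r) F)) :
    Nat.card {T : End F V // ((∀ i < k, T (w i) = w (i + 1)) ∧
        T (w k) ∈ Submodule.span F (Set.range fun i : Fin (k + 1) => w i)) ∧ IsNilpotent T}
      * Nat.card F ^ (k + 1 + r) =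
    Nat.card {T : End F V // (∀ i < k, T (w i) = w (i + 1)) ∧
        T (w k) ∈ Submodule.span F (Set.range fun i : Fin (k + 1) => w i)} := by
  simp only [← LinearMap.mem_span_chain_iff_exists_toLin w b hb]
  have hinj : Function.Injective
      (fun x : (Fin (k + 1) → F) × Matrix (Fin (k + 1)) (Fin r) F × Matrix (Fin r) (Fin r) F =>
        Matrix.toLinAlgEquiv b
          (Matrix.fromBlocks (Matrix.shiftWithLastCol x.1) x.2.1 0 x.2.2)) := by
    rintro ⟨c, A, D⟩ ⟨c', A', D'⟩ h
    have h := (Matrix.toLinAlgEquiv b).injective h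
    rw [Matrix.fromBlocks_inj] at h
    obtain ⟨h1, rfl, -, rfl⟩ := h
    have : c = c' := by
      ext i
      simpa [Matrix.shiftWithLastCol] using congrFun (congrFun h1 i) (Fin.last k)
    rw [this]
  have h1 := Nat.card_subtype_mem_range_and hinj IsNilpotent
  have h2 := Nat.card_subtype_mem_range_and hinj fun _ => True
  simp only [and_true] at h2
  rw [h1, h2]
  have e1 : Nat.card {x : (Fin (k + 1) → F) × Matrix (Fin (k + 1)) (Fin r) F ×
      Matrix (Fin r) (Fin r) F // IsNilpotent (Matrix.toLinAlgEquiv b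
          (Matrix.fromBlocks (Matrix.shiftWithLastCol x.1) x.2.1 0 x.2.2))} =
      Nat.card (Matrix (Fin (k + 1)) (Fin r) F ×
        {D : Matrix (Fin r) (Fin r) F // IsNilpotent D}) := by
    refine Nat.card_congr
      { toFun := fun x => (x.1.2.1, ⟨x.1.2.2, ?_⟩)
        invFun := fun y => ⟨(0, y.1, y.2.1), ?_⟩
        left_inv := ?_
        right_inv := fun y => rfl }
    · have := x.2
      rw [IsNilpotent.map_iff (Matrix.toLinAlgEquiv b).injective,
        Matrix.isNilpotent_fromBlocks_zero₂₁_iff] at this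
      exact this.2
    · rw [IsNilpotent.map_iff (Matrix.toLinAlgEquiv b).injective,
        Matrix.isNilpotent_fromBlocks_zero₂₁_iff, Matrix.isNilpotent_shiftWithLastCol_iff]
      exact ⟨rfl, y.2.2⟩
    · rintro ⟨⟨c, A, D⟩, h⟩
      rw [IsNilpotent.map_iff (Matrix.toLinAlgEquiv b).injective,
        Matrix.isNilpotent_fromBlocks_zero₂₁_iff, Matrix.isNilpotent_shiftWithLastCol_iff] at h
      obtain ⟨rfl : c = 0, -⟩ := h
      rfl
  rw [e1, Nat.card_congr (Equiv.subtypeUnivEquiv fun _ => trivial), Nat.card_prod, Nat.card_prod,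
    Nat.card_prod, ← hr, Nat.card_fun, Nat.card_fin, pow_add]
  ring

/-- An independent chain `w 0, …, w k` is part of a basis. -/
theorem exists_basis_sum_fin_extending {m k : ℕ} [Module.Finite F V] (hm : finrank F V = m)
    (w : ℕ → V) (hw : LinearIndependent F fun i : Fin (k + 1) => w i) :
    ∃ r, k + 1 + r = m ∧ ∃ b : Basis (Fin (k + 1) ⊕ Fin r) F V, ∀ i, b (Sum.inl i) = w i := by
  classical
  let b := Basis.sumExtend hw
  have : Finite (Fin (k + 1) ⊕ Basis.sumExtendIndex hw) := Module.Finite.finite_basis b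
  have : Finite (Basis.sumExtendIndex hw) :=
    Finite.of_injective (Sum.inr : _ → Fin (k + 1) ⊕ Basis.sumExtendIndex hw) Sum.inr_injective
  have := Fintype.ofFinite (Basis.sumExtendIndex hw)
  let e := Fintype.equivFin (Basis.sumExtendIndex hw)
  refine ⟨_, ?_, b.reindex (Equiv.sumCongr (Equiv.refl _) e), fun i => ?_⟩
  · rw [← hm, finrank_eq_card_basis b, Fintype.card_sum, Fintype.card_fin]
  · simp only [b, Basis.sumExtend, Basis.reindex_apply, Basis.extend_apply_self]
    rfl

/-- The fraction of nilpotents is `|F|⁻ᵐ` also among the endomorphisms sending `w i` to `w (i + 1)`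
for `i < k`, where `w 0, …, w k` is independent. The proof is by descending induction on `k`: the
value `T (w k)` either prolongs the chain or closes it. -/
theorem LinearMap.card_nilpotent_of_chain [Finite F] [Module.Finite F V] {m : ℕ}
    (hm : finrank F V = m)
    (ih : ∀ r < m, Nat.card {D : Matrix (Fin r) (Fin r) F // IsNilpotent D} * Nat.card F ^ r =
      Nat.card (Matrix (Fin r) (Fin r) F))
    (d k : ℕ) (hd : k + 1 + d = m) (w : ℕ → V)
    (hw : LinearIndependent F fun i : Fin (k + 1) => w i) :
    Nat.card {T : End F V // (∀ i < k, T (w i) = w (i + 1)) ∧ IsNilpotent T} * Nat.card F ^ m =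
      Nat.card {T : End F V // ∀ i < k, T (w i) = w (i + 1)} := by
  classical
  have : Finite V := Module.finite_of_finite F
  have : Finite (End F V) := Module.finite_of_finite F
  let W := fun k (w : ℕ → V) => Submodule.span F (Set.range fun i : Fin (k + 1) => w i)
  -- Prolonging an independent chain by `u ∉ W k w` gives an independent chain.
  have indep {k : ℕ} {w : ℕ → V} (hw : LinearIndependent F fun i : Fin (k + 1) => w i) {u : V}
      (hu : u ∉ W k w) :
      LinearIndependent F fun i : Fin (k + 1 + 1) => Function.update w (k + 1) u i := by
    convert hw.finSnoc hu using 1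
    ext i
    refine Fin.lastCases ?_ (fun i => ?_) i
    · simp
    · simp [Function.update_of_ne i.2.ne]
  have step {k : ℕ} {w : ℕ → V} (hw : LinearIndependent F fun i : Fin (k + 1) => w i)
      (H : ∀ u ∉ W k w, Nat.card {T : End F V //
          (∀ i < k + 1, T (Function.update w (k + 1) u i) = Function.update w (k + 1) u (i + 1)) ∧
            IsNilpotent T} * Nat.card F ^ m =
        Nat.card {T : End F V //
          ∀ i < k + 1, T (Function.update w (k + 1) u i) = Function.update w (k + 1) u (i + 1)}) :
      Nat.card {T : End F V // (∀ i < k, T (w i) = w (i + 1)) ∧ IsNilpotent T} * Nat.card F ^ m =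
        Nat.card {T : End F V // ∀ i < k, T (w i) = w (i + 1)} := by
    -- All `T` for which the chain closes at `w k` are put into one fibre.
    refine Nat.card_subtype_and_mul_eq_of_fiberwise _ _ _
      (fun T => if T (w k) ∈ W k w then 0 else T (w k)) fun u => ?_
    by_cases hu : u ∈ W k w
    · by_cases hu0 : u = 0
      · -- The fibre over `0` consists of the endomorphisms for which `W k w` is invariant.
        subst hu0
        obtain ⟨r, hr, b, hb⟩ := exists_basis_sum_fin_extending hm w hw
        have h := LinearMap.card_nilpotent_of_invariant_chain w b hb (ih r (by omega))
        have e (T : End F V) :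
            (if T (w k) ∈ W k w then 0 else T (w k)) = 0 ↔ T (w k) ∈ W k w := by
          split_ifs with hT
          · simp [hT]
          · simp only [hT, iff_false]
            exact fun h0 => hT (h0 ▸ zero_mem _)
        simp only [e]
        rw [hr] at h
        exact h
      · have : ∀ T : End F V, ¬ (if T (w k) ∈ W k w then 0 else T (w k)) = u := by
          intro T h
          split_ifs at h with hT
          · exact hu0 h.symm
          · exact hT (h ▸ hu)
        simp [this]
    · have e (T : End F V) : ((∀ i < k, T (w i) = w (i + 1)) ∧
          (if T (w k) ∈ W k w then 0 else T (w k)) = u) ↔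
          ∀ i < k + 1,
            T (Function.update w (k + 1) u i) = Function.update w (k + 1) u (i + 1) := by
        have e1 : (if T (w k) ∈ W k w then 0 else T (w k)) = u ↔ T (w k) = u := by
          split_ifs with hT
          · exact ⟨fun h => absurd (h ▸ zero_mem _) hu, fun h => absurd (h ▸ hT) hu⟩
          · rfl
        rw [e1, Nat.forall_lt_succ_right]
        refine and_congr (forall₂_congr fun i hi => ?_) ?_
        · rw [Function.update_of_ne (by omega), Function.update_of_ne (by omega)]
        · rw [Function.update_of_ne (by omega), Function.update_self]
      simp only [e]
      exact H u hu
  induction d generalizing k w with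
  | zero =>
    refine step hw fun u hu => ?_
    have := (indep hw hu).fintype_card_le_finrank
    simp only [Fintype.card_fin] at this
    omega
  | succ d ihd => exact step hw fun u hu => ihd (k + 1) (by omega) _ (indep hw hu)

end ChainExtensions

/-- **The Fine–Herstein theorem**: a uniformly random `m × m` matrix over a field with `q` elements
is nilpotent with probability `q⁻ᵐ`. -/
theorem Matrix.card_nilpotent_fin {F : Type*} [Field F] [Finite F] (m : ℕ) :
    Nat.card {D : Matrix (Fin m) (Fin m) F // IsNilpotent D} * Nat.card F ^ m =
      Nat.card (Matrix (Fin m) (Fin m) F) := by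
  induction m using Nat.strong_induction_on with
  | _ m ih =>
  rcases m with _ | m
  · have : ∀ D : Matrix (Fin 0) (Fin 0) F, IsNilpotent D := fun D => ⟨1, Subsingleton.elim _ _⟩
    rw [pow_zero, mul_one, Nat.card_congr (Equiv.subtypeUnivEquiv this)]
  · let v : Fin (m + 1) → F := Pi.single 0 1
    have hv : v ≠ 0 := fun h => by simpa [v] using congrFun h 0
    have h := LinearMap.card_nilpotent_of_chain (V := Fin (m + 1) → F) (m := m + 1) (by simp) ih
      m 0 (by omega) (fun _ => v) ((linearIndependent_unique_iff (ι := Fin 1)).2 hv)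
    simp only [not_lt_zero, IsEmpty.forall_iff, implies_true, true_and] at h
    let e := Matrix.toLinAlgEquiv' (R := F) (n := Fin (m + 1))
    rw [Nat.card_congr (Equiv.subtypeUnivEquiv fun _ => trivial), ← Nat.card_congr e.toEquiv] at h
    rw [← h]
    congr 1
    exact Nat.card_congr (e.toEquiv.subtypeEquiv fun T => (IsNilpotent.map_iff e.injective).symm)

theorem Matrix.card_nilpotent {F ι : Type*} [Field F] [Finite F] [Fintype ι] [DecidableEq ι] :
    Nat.card {D : Matrix ι ι F // IsNilpotent D} * Nat.card F ^ Fintype.card ι =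
      Nat.card (Matrix ι ι F) := by
  let e := Matrix.reindexAlgEquiv F F (Fintype.equivFin ι)
  rw [Nat.card_congr e.toEquiv, ← Matrix.card_nilpotent_fin]
  congr 1
  exact Nat.card_congr (e.toEquiv.subtypeEquiv fun D => (IsNilpotent.map_iff e.injective).symm)

/-! ### The centralizer of a nilpotent matrix in Jordan form -/

namespace Matrix

variable {F ι : Type*} [Field F] (lam : ι → ℕ)

/-- The direct sum of the nilpotent Jordan blocks of orders `lam i`, with ones on the
superdiagonal. -/
def jordanShift (F : Type*) [Field F] (lam : ι → ℕ) [DecidableEq ι] :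
    Matrix (Σ i, Fin (lam i)) (Σ i, Fin (lam i)) F :=
  of fun p r => if p.1 = r.1 ∧ (p.2 : ℕ) + 1 = r.2 then 1 else 0

section Shift

variable {lam} [Fintype ι] [DecidableEq ι] (M : Matrix (Σ i, Fin (lam i)) (Σ i, Fin (lam i)) F)

theorem mul_jordanShift_zero (p : Σ i, Fin (lam i)) {j : ι} (hj : 0 < lam j) :
    (M * jordanShift F lam) p ⟨j, ⟨0, hj⟩⟩ = 0 := by
  simp [mul_apply, jordanShift]

theorem mul_jordanShift_succ (p : Σ i, Fin (lam i)) {j : ι} {b : ℕ} (hb : b + 1 < lam j) :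
    (M * jordanShift F lam) p ⟨j, ⟨b + 1, hb⟩⟩ = M p ⟨j, ⟨b, by omega⟩⟩ := by
  rw [mul_apply, Finset.sum_eq_single ⟨j, ⟨b, by omega⟩⟩]
  · simp [jordanShift]
  · rintro ⟨i, a⟩ - h
    rw [jordanShift, of_apply, if_neg, mul_zero]
    rintro ⟨rfl : i = j, h2 : (a : ℕ) + 1 = b + 1⟩
    exact h (by congr; ext; simpa using h2)
  · simp

theorem jordanShift_mul_last (r : Σ i, Fin (lam i)) {i : ι} {a : ℕ} (ha : a < lam i)
    (ha' : a + 1 = lam i) : (jordanShift F lam * M) ⟨i, ⟨a, ha⟩⟩ r = 0 := by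
  rw [mul_apply]
  refine Finset.sum_eq_zero ?_
  rintro ⟨k, c⟩ -
  rw [jordanShift, of_apply, if_neg, zero_mul]
  rintro ⟨rfl : i = k, h2 : a + 1 = c⟩
  omega

theorem jordanShift_mul_succ (r : Σ i, Fin (lam i)) {i : ι} {a : ℕ} (ha : a + 1 < lam i) :
    (jordanShift F lam * M) ⟨i, ⟨a, by omega⟩⟩ r = M ⟨i, ⟨a + 1, ha⟩⟩ r := by
  rw [mul_apply, Finset.sum_eq_single ⟨i, ⟨a + 1, ha⟩⟩]
  · simp [jordanShift]
  · rintro ⟨k, c⟩ - h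
    rw [jordanShift, of_apply, if_neg, zero_mul]
    rintro ⟨rfl : i = k, h2 : a + 1 = c⟩
    exact h (by congr; ext; simpa using h2.symm)
  · simp

end Shift

/-- Coordinates on the centralizer of `jordanShift F lam`: the block in position `(i, j)` of a
matrix commuting with it is determined by `min (lam i) (lam j)` scalars. -/
abbrev ToeplitzCoeffs (F : Type*) (lam : ι → ℕ) : Type _ :=
  (p : ι × ι) → Fin (min (lam p.1) (lam p.2)) → F

namespace ToeplitzCoeffs

variable {lam}

/-- The scalar number `n` of the block `(i, j)`, extended by zero to all natural `n`. -/
def coeff (c : ToeplitzCoeffs F lam) (i j : ι) (n : ℕ) : F :=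
  if h : n < min (lam i) (lam j) then c (i, j) ⟨n, h⟩ else 0

theorem coeff_of_le (c : ToeplitzCoeffs F lam) {i j : ι} {n : ℕ}
    (h : lam i ≤ n ∨ lam j ≤ n) : c.coeff i j n = 0 :=
  dif_neg (by rw [lt_min_iff]; omega)

/-- The matrix with upper triangular Toeplitz blocks given by `c`. The scalars of the block
`(i, j)` form its last column, continued by zeros, and the entries are constant along diagonals. -/
def toMatrix (c : ToeplitzCoeffs F lam) : Matrix (Σ i, Fin (lam i)) (Σ i, Fin (lam i)) F :=
  of fun p r => c.coeff p.1 r.1 (p.2 + (lam r.1 - 1 - r.2))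

theorem toMatrix_injective : Function.Injective (toMatrix : ToeplitzCoeffs F lam → _) := by
  intro c d h
  funext ⟨i, j⟩ ⟨n, hn⟩
  have hn' : n < lam i ∧ n < lam j := lt_min_iff.1 hn
  have := congrFun (congrFun h ⟨i, ⟨n, hn'.1⟩⟩) ⟨j, ⟨lam j - 1, by omega⟩⟩
  simpa [toMatrix, coeff, hn'.1, hn'.2] using this

theorem commute_toMatrix [Fintype ι] [DecidableEq ι] (c : ToeplitzCoeffs F lam) :
    Commute c.toMatrix (jordanShift F lam) := by
  ext ⟨i, ⟨a, ha⟩⟩ ⟨j, ⟨b, hb⟩⟩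
  rcases Nat.lt_or_ge (a + 1) (lam i) with ha' | ha'
  · rw [jordanShift_mul_succ _ _ ha']
    rcases b with _ | b
    · rw [mul_jordanShift_zero, toMatrix, of_apply, coeff_of_le]
      simp only
      omega
    · rw [mul_jordanShift_succ]
      simp only [toMatrix, of_apply]
      congr 1
      omega
  · rw [jordanShift_mul_last _ _ _ (by omega)]
    rcases b with _ | b
    · rw [mul_jordanShift_zero]
    · rw [mul_jordanShift_succ, toMatrix, of_apply, coeff_of_le]
      simp only
      omega

end ToeplitzCoeffs

variable {lam}

/-- A matrix commutes with a nilpotent Jordan matrix if and only if its blocks are upper triangular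
Toeplitz matrices. -/
theorem commute_jordanShift_iff [Fintype ι] [DecidableEq ι]
    {M : Matrix (Σ i, Fin (lam i)) (Σ i, Fin (lam i)) F} :
    Commute M (jordanShift F lam) ↔ ∃ c : ToeplitzCoeffs F lam, c.toMatrix = M := by
  constructor
  swap
  · rintro ⟨c, rfl⟩
    exact c.commute_toMatrix
  intro hM
  have hM' : ∀ p r, (M * jordanShift F lam) p r = (jordanShift F lam * M) p r := fun p r => by
    rw [hM.eq]
  -- The entries of `M`, extended by zero to all natural numbers.
  let m (i j : ι) (a b : ℕ) : F :=
    if h : a < lam i ∧ b < lam j then M ⟨i, ⟨a, h.1⟩⟩ ⟨j, ⟨b, h.2⟩⟩ else 0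
  have hm1 (i j : ι) (a b : ℕ) (hb : b + 1 < lam j) : m i j a b = m i j (a + 1) (b + 1) := by
    rcases Nat.lt_or_ge a (lam i) with ha | ha
    · have h := hM' ⟨i, ⟨a, ha⟩⟩ ⟨j, ⟨b + 1, hb⟩⟩
      rw [mul_jordanShift_succ] at h
      rcases Nat.lt_or_ge (a + 1) (lam i) with ha' | ha'
      · rw [jordanShift_mul_succ _ _ ha'] at h
        simp only [m]
        rw [dif_pos ⟨ha, by omega⟩, dif_pos ⟨ha', hb⟩, h]
      · rw [jordanShift_mul_last _ _ _ (by omega)] at h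
        simp only [m]
        rw [dif_pos ⟨ha, by omega⟩, dif_neg (by omega), h]
    · simp only [m]
      rw [dif_neg (by omega), dif_neg (by omega)]
  have hm2 (i j : ι) (a b : ℕ) (hab : b < a) (hb : b < lam j) : m i j a b = 0 := by
    induction b generalizing a with
    | zero =>
      obtain ⟨a, rfl⟩ := Nat.exists_eq_succ_of_ne_zero hab.ne'
      by_cases ha : a + 1 < lam i
      · have h := hM' ⟨i, ⟨a, by omega⟩⟩ ⟨j, ⟨0, hb⟩⟩
        rw [mul_jordanShift_zero, jordanShift_mul_succ _ _ ha] at h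
        simp only [m]
        rw [dif_pos ⟨ha, hb⟩, h]
      · exact dif_neg (by omega)
    | succ b ih =>
      obtain ⟨a, rfl⟩ := Nat.exists_eq_succ_of_ne_zero (Nat.ne_zero_of_lt hab)
      rw [← hm1 i j a b hb]
      exact ih a (by omega) (by omega)
  have hm3 (i j : ι) (a b s : ℕ) (hb : b + s < lam j) : m i j a b = m i j (a + s) (b + s) := by
    induction s with
    | zero => rfl
    | succ s ih => rw [ih (by omega), hm1 i j (a + s) (b + s) hb]; rfl
  refine ⟨fun p n => m p.1 p.2 n (lam p.2 - 1), ?_⟩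
  ext ⟨i, ⟨a, ha⟩⟩ ⟨j, ⟨b, hb⟩⟩
  have h1 : m i j a b = M ⟨i, ⟨a, ha⟩⟩ ⟨j, ⟨b, hb⟩⟩ := dif_pos ⟨ha, hb⟩
  have h2 := hm3 i j a b (lam j - 1 - b) (by omega)
  rw [show b + (lam j - 1 - b) = lam j - 1 by omega] at h2
  rw [← h1, h2, ToeplitzCoeffs.toMatrix, of_apply, ToeplitzCoeffs.coeff]
  simp only
  split_ifs with h
  · rfl
  · rw [lt_min_iff, not_and_or] at h
    rcases h with h | h
    · simp only [m]
      rw [dif_neg fun h' => h h'.1]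
    · exact (hm2 _ _ _ _ (by omega) (by omega)).symm

namespace ToeplitzCoeffs

/-- The matrix of the diagonal scalars of the blocks `(i, j)` with `lam i = lam j = d`: the entries
on the main diagonal of such a block are all its scalar number `d - 1`. -/
def levelBlock (c : ToeplitzCoeffs F lam) (d : ℕ) : Matrix {i // lam i = d} {i // lam i = d} F :=
  of fun i j => c.coeff i j (d - 1)

/-- Listing the basis vectors by their height in the Jordan chain, and then by decreasing distance
to the top of the chain, makes a matrix with Toeplitz blocks block triangular. Its diagonal blocks
are copies of the `levelBlock`s. -/
theorem isNilpotent_toMatrix_iff [Fintype ι] [DecidableEq ι] (hlam : ∀ i, 0 < lam i)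
    (c : ToeplitzCoeffs F lam) :
    IsNilpotent c.toMatrix ↔ ∀ d ∈ Set.range lam, IsNilpotent (c.levelBlock d) := by
  let key (p : Σ i, Fin (lam i)) : ℕ ×ₗ ℕᵒᵈ := toLex ((p.2 : ℕ), OrderDual.toDual (lam p.1 - p.2))
  have htri : c.toMatrix.BlockTriangular key := by
    rintro ⟨i, ⟨a, ha⟩⟩ ⟨j, ⟨b, hb⟩⟩ h
    simp only [key, Prod.Lex.toLex_lt_toLex, OrderDual.toDual_lt_toDual] at h
    rw [toMatrix, of_apply, coeff_of_le]
    simp only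
    omega
  have hblock (q : Σ i, Fin (lam i)) :
      IsNilpotent (c.toMatrix.toSquareBlock key (key q)) ↔ IsNilpotent (c.levelBlock (lam q.1)) := by
    have hkey (p : Σ i, Fin (lam i)) : key p = key q ↔ (p.2 : ℕ) = q.2 ∧ lam p.1 = lam q.1 := by
      have := p.2.2
      have := q.2.2
      simp only [key, toLex_inj, Prod.mk.injEq, OrderDual.toDual_inj]
      omega
    let e : {p // key p = key q} ≃ {i // lam i = lam q.1} :=
      { toFun := fun p => ⟨p.1.1, ((hkey p.1).1 p.2).2⟩
        invFun := fun i => ⟨⟨i.1, ⟨q.2, by rw [i.2]; exact q.2.2⟩⟩, (hkey _).2 ⟨rfl, i.2⟩⟩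
        left_inv := by
          rintro ⟨⟨i, a⟩, h⟩
          have := (hkey _).1 h
          simp only [Subtype.mk.injEq, Sigma.mk.injEq, heq_eq_eq, true_and]
          ext
          exact this.1.symm
        right_inv := fun i => rfl }
    rw [← IsNilpotent.map_iff (reindexAlgEquiv F F e).injective]
    have : reindexAlgEquiv F F e (c.toMatrix.toSquareBlock key (key q)) =
        c.levelBlock (lam q.1) := by
      ext ⟨i, hi⟩ ⟨j, hj⟩
      have := q.2.2
      simp only [coe_reindexAlgEquiv, reindex_apply, submatrix_apply, toSquareBlock_def, of_apply,
        toMatrix, levelBlock, e, Equiv.coe_fn_symm_mk]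
      congr 1
      omega
    rw [this]
  rw [htri.isNilpotent_iff]
  constructor
  · rintro h _ ⟨i, rfl⟩
    exact (hblock ⟨i, ⟨0, hlam i⟩⟩).1 (h _ ⟨_, rfl⟩)
  · rintro h _ ⟨q, rfl⟩
    exact (hblock q).2 (h _ ⟨_, rfl⟩)

/-- The family of all level blocks, as an additive map. -/
def levelBlocks (F : Type*) [Field F] (lam : ι → ℕ) : ToeplitzCoeffs F lam →+
    ((d : Set.range lam) → Matrix {i // lam i = d} {i // lam i = d} F) where
  toFun c d := c.levelBlock d
  map_zero' := by
    funext d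
    ext i j
    simp [levelBlock, coeff]
  map_add' c c' := by
    funext d
    ext i j
    simp only [levelBlock, coeff, of_apply, Pi.add_apply, add_apply]
    split_ifs <;> simp

/-- The entries of the level blocks are independent coordinates: the block `(i, j)` with
`lam i = lam j = d` contributes its scalar number `d - 1` to the block of level `d` and to no
other. -/
theorem levelBlocks_surjective (hlam : ∀ i, 0 < lam i) :
    Function.Surjective (levelBlocks F lam) := by
  classical
  intro B
  refine ⟨fun p _ => if h : lam p.1 = lam p.2 then
    B ⟨lam p.2, ⟨p.2, rfl⟩⟩ ⟨p.1, h⟩ ⟨p.2, rfl⟩ else 0, ?_⟩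
  funext ⟨d, hd⟩
  ext ⟨i, hi⟩ ⟨j, hj⟩
  simp only at hi hj
  subst hj
  have := hlam j
  simp only [levelBlocks, AddMonoidHom.coe_mk, ZeroHom.coe_mk, levelBlock, of_apply, coeff]
  rw [dif_pos (by rw [lt_min_iff]; omega), dif_pos hi]

end ToeplitzCoeffs

/-- In the centralizer of a nilpotent matrix with `l` Jordan blocks the fraction of nilpotents is
`|F|⁻ˡ`. -/
theorem card_nilpotent_commute_jordanShift [Finite F] [Fintype ι] [DecidableEq ι]
    (hlam : ∀ i, 0 < lam i) :
    Nat.card {M : Matrix (Σ i, Fin (lam i)) (Σ i, Fin (lam i)) F //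
        IsNilpotent M ∧ Commute M (jordanShift F lam)} * Nat.card F ^ Fintype.card ι =
      Nat.card F ^ ∑ i, ∑ j, min (lam i) (lam j) := by
  classical
  have hcoeffs : Nat.card (ToeplitzCoeffs F lam) =
      Nat.card F ^ ∑ i, ∑ j, min (lam i) (lam j) := by
    rw [Nat.card_pi, ← Finset.univ_product_univ, Finset.prod_product, ← Finset.prod_pow_eq_pow_sum]
    refine Finset.prod_congr rfl fun i _ => ?_
    rw [← Finset.prod_pow_eq_pow_sum]
    refine Finset.prod_congr rfl fun j _ => ?_
    rw [Nat.card_fun, Nat.card_fin]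
  have hcard := Nat.card_subtype_mem_range_and (ToeplitzCoeffs.toMatrix_injective (F := F)
    (lam := lam)) IsNilpotent
  simp only [← commute_jordanShift_iff, ToeplitzCoeffs.isNilpotent_toMatrix_iff hlam,
    and_comm (a := Commute _ _)] at hcard
  have hfib := AddMonoidHom.card_subtype_comp_mul_card (ToeplitzCoeffs.levelBlocks F lam)
    (ToeplitzCoeffs.levelBlocks_surjective hlam) fun B => ∀ d, IsNilpotent (B d)
  have hB : Nat.card {B : (d : Set.range lam) → Matrix {i // lam i = d} {i // lam i = d} F //
      ∀ d, IsNilpotent (B d)} * Nat.card F ^ Fintype.card ι =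
      Nat.card ((d : Set.range lam) → Matrix {i // lam i = d} {i // lam i = d} F) := by
    have hι : Fintype.card ι = ∑ d : Set.range lam, Fintype.card {i // lam i = d} := by
      rw [← Fintype.card_sigma]
      exact Fintype.card_congr
        { toFun := fun i => ⟨⟨lam i, ⟨i, rfl⟩⟩, ⟨i, rfl⟩⟩
          invFun := fun x => x.2.1
          left_inv := fun i => rfl
          right_inv := by rintro ⟨⟨_, h⟩, ⟨i, h'⟩⟩; cases h'; rfl }
    rw [Nat.card_congr (Equiv.subtypePiEquivPi
      (p := fun (d : Set.range lam) (D : Matrix {i // lam i = d} {i // lam i = d} F) =>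
        IsNilpotent D)), Nat.card_pi,
      Nat.card_pi, hι, ← Finset.prod_pow_eq_pow_sum, ← Finset.prod_mul_distrib]
    exact Finset.prod_congr rfl fun d _ => card_nilpotent
  have hpos : 0 < Nat.card {B : (d : Set.range lam) → Matrix {i // lam i = d} {i // lam i = d} F //
      ∀ d, IsNilpotent (B d)} :=
    have : Nonempty {B : (d : Set.range lam) → Matrix {i // lam i = d} {i // lam i = d} F //
      ∀ d, IsNilpotent (B d)} := ⟨0, fun _ => IsNilpotent.zero⟩
    Nat.card_pos
  rw [hcard, ← hcoeffs]
  refine Nat.eq_of_mul_eq_mul_right hpos ?_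
  rw [← hfib, ← hB]
  simp only [ToeplitzCoeffs.levelBlocks, AddMonoidHom.coe_mk, ZeroHom.coe_mk, Subtype.forall]
  ring

end Matrix

/-! ### Partitions and the Jordan matrix of a linear polynomial -/

namespace Nat.Partition

theorem univ_val_map_partsList_get {n : ℕ} (l : n.Partition) :
    (Finset.univ : Finset (Fin l.partsList.length)).val.map l.partsList.get = l.parts := by
  rw [Fin.univ_val_map, List.ofFn_get, partsList, Multiset.sort_eq]

theorem conjPart_eq_card_filter {n : ℕ} (l : n.Partition) (k : ℕ) :
    l.conjPart k =
      ((Finset.univ : Finset (Fin l.partsList.length)).filter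
        fun i => k ≤ l.partsList.get i).card := by
  rw [conjPart, ← univ_val_map_partsList_get, Multiset.countP_map]
  rfl

theorem partsList_get_mem {n : ℕ} (l : n.Partition) (i : Fin l.partsList.length) :
    l.partsList.get i ∈ l.parts := by
  rw [← univ_val_map_partsList_get]
  exact Multiset.mem_map_of_mem _ (Finset.mem_univ i)

theorem length_partsList {n : ℕ} (l : n.Partition) : l.partsList.length = l.length := by
  rw [length, partsList, Multiset.length_sort]

/-- Both sides count triples `(i, j, k)` with `1 ≤ k ≤ λ_i` and `k ≤ λ_j`. -/
theorem sum_min_eq_pairing {n : ℕ} (l : n.Partition) :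
    ∑ i, ∑ j, min (l.partsList.get i) (l.partsList.get j) = l.pairing l := by
  have hmin (i j : Fin l.partsList.length) : min (l.partsList.get i) (l.partsList.get j) =
      ∑ k ∈ Finset.Icc 1 n, (if k ≤ l.partsList.get i then 1 else 0) *
        (if k ≤ l.partsList.get j then 1 else 0) := by
    have hi : l.partsList.get i ≤ n :=
      (Multiset.le_sum_of_mem (l.partsList_get_mem i)).trans_eq l.parts_sum
    have h : Finset.Icc 1 (min (l.partsList.get i) (l.partsList.get j)) =
        (Finset.Icc 1 n).filter fun k => k ≤ l.partsList.get j ∧ k ≤ l.partsList.get i := by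
      ext k
      simp only [Finset.mem_Icc, Finset.mem_filter, le_min_iff]
      omega
    simp only [mul_ite, mul_one, mul_zero, ← ite_and, ← Finset.card_filter]
    rw [← h, Nat.card_Icc, Nat.add_sub_cancel]
  simp only [hmin, pairing, conjPart_eq_card_filter, Finset.card_filter, Finset.sum_mul_sum]
  rw [Finset.sum_comm (s := Finset.Icc 1 n)]
  exact Finset.sum_congr rfl fun i _ => Finset.sum_comm

end Nat.Partition

section LinearPolynomial

variable {F : Type*} [Field F] {n : ℕ} (l : n.Partition) (a₀ : F)

/-- For a linear polynomial the index within a companion block carries no information. -/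
noncomputable def jordanIndexEquiv : JordanIndex (X - C a₀) l ≃ Σ i, Fin (l.partsList.get i) :=
  Equiv.sigmaCongrRight fun _ =>
    (Equiv.prodCongr (Equiv.refl _) (finCongr (natDegree_X_sub_C a₀))).trans (Equiv.prodUnique _ _)

theorem reindex_jordanMat :
    Matrix.reindex (jordanIndexEquiv l a₀) (jordanIndexEquiv l a₀) (jordanMat (X - C a₀) l) =
      Matrix.scalar _ a₀ + Matrix.jordanShift F l.partsList.get := by
  have hcomp (x y : Fin (X - C a₀).natDegree) : companionMat (X - C a₀) x y = a₀ := by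
    have h := natDegree_X_sub_C a₀
    have hx : (x : ℕ) = 0 := by omega
    have hy : (y : ℕ) = 0 := by omega
    simp [companionMat, hx, hy]
  have hone (x y : Fin (X - C a₀).natDegree) :
      (1 : Matrix (Fin (X - C a₀).natDegree) (Fin (X - C a₀).natDegree) F) x y = 1 := by
    have h := natDegree_X_sub_C a₀
    have : x = y := by ext; omega
    rw [this, Matrix.one_apply_eq]
  ext p r
  obtain ⟨⟨i, a, x⟩, rfl⟩ := (jordanIndexEquiv l a₀).surjective p
  obtain ⟨⟨j, b, y⟩, rfl⟩ := (jordanIndexEquiv l a₀).surjective r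
  simp only [Matrix.reindex_apply, Matrix.submatrix_apply, Equiv.symm_apply_apply, jordanMat,
    Matrix.add_apply]
  simp only [jordanIndexEquiv, Equiv.sigmaCongrRight_apply, Equiv.trans_apply,
    Equiv.prodCongr_apply, Equiv.prodUnique_apply, Prod.map_fst, Equiv.refl_apply,
    Matrix.jordanShift, Matrix.of_apply, Matrix.scalar_apply, Matrix.diagonal_apply]
  by_cases hij : i = j
  · subst hij
    rw [Matrix.blockDiagonal'_apply_eq]
    simp only [jordanBlockMat, Matrix.of_apply, hcomp, hone]
    by_cases hab : a = b
    · subst hab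
      simp
    · simp [hab]
  · rw [Matrix.blockDiagonal'_apply_ne _ _ _ hij]
    simp [hij]

end LinearPolynomial

theorem mainTheorem5 {F : Type*} [Field F] [Finite F] {n : ℕ} (l : n.Partition) (a₀ : F) :
    Nat.card {M : Matrix (JordanIndex (X - C a₀) l) (JordanIndex (X - C a₀) l) F //
        IsNilpotent M ∧ Commute M (jordanMat (X - C a₀) l)} =
      Nat.card F ^ (l.pairing l - l.length) := by
  have hcard : Nat.card {M : Matrix (JordanIndex (X - C a₀) l) (JordanIndex (X - C a₀) l) F //
        IsNilpotent M ∧ Commute M (jordanMat (X - C a₀) l)} =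
      Nat.card {M : Matrix (Σ i, Fin (l.partsList.get i)) (Σ i, Fin (l.partsList.get i)) F //
        IsNilpotent M ∧ Commute M (Matrix.jordanShift F l.partsList.get)} := by
    let e := Matrix.reindexAlgEquiv F F (jordanIndexEquiv l a₀)
    refine Nat.card_congr (e.toEquiv.subtypeEquiv fun M =>
      and_congr (IsNilpotent.map_iff e.injective).symm ?_)
    have he : e (jordanMat (X - C a₀) l) = _ := reindex_jordanMat l a₀
    have hs : Commute (e M) (Matrix.scalar _ a₀) :=
      (Matrix.scalar_commute a₀ (fun _ => mul_comm _ _) (e M)).symm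
    change _ ↔ Commute (e M) _
    rw [← commute_map_iff e.injective, he]
    constructor
    · intro h
      simpa using h.sub_right hs
    · exact fun h => hs.add_right h
  have h := Matrix.card_nilpotent_commute_jordanShift (F := F) (lam := l.partsList.get)
    fun i => l.parts_pos (l.partsList_get_mem i)
  rw [← hcard, l.sum_min_eq_pairing, (Fintype.card_fin _).trans l.length_partsList] at h
  have hq : 0 < Nat.card F ^ l.length := pow_pos Nat.card_pos _
  refine Nat.eq_of_mul_eq_mul_right hq ?_
  rw [h, ← pow_add, Nat.sub_add_cancel l.length_le_pairing]
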